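/- Let $n\ge 1$ and $D\ge 0$. Let $\mathcal S^D$ be the set of functions $\zeta:[0,\infty]\to[0,\infty]$ for which there is a nondecreasing $\varsigma:[0,\infty]\to[0,\infty]$ with $\varsigma(r)>0$ for $r>0$ and $$\lim_{r\to 0+}\frac{\varsigma(\lambda r)}{\varsigma(r)}=\lambda^D\qquad\text{for every }\lambda>0,$$ such that for every $\varepsilon>0$ the inequalities $\zeta\le(1+\varepsilon)\varsigma$ and $\varsigma\le(1+\varepsilon)\zeta$ hold on some neighbourhood of $0$ in $[0,\infty]$. For $\zeta\in\mathcal S^D$ let $k_\zeta$ be the (Borel regular, metric) outer measure on Euclidean space $\mathbb R^n$ given by $$k_\zeta(A)=\sup_{\delta>0}\ \inf\Big\{\sum_{S\in\mathcal C}\zeta(\operatorname{diam}S)\ :\ \mathcal C\text{ a countable cover of }A\text{ by sets of diameter}\le\delta\Big\}$$ (finite and empty families count as countable), regarded as a measure. Let $O',O\subseteq\mathbb R^n$ be open and let $\Phi$ be a conformal map from $O'$ onto $O$, i.e. a bijection $O'\to O$ that is differentiable at every $x\in O'$ with $\Phi'(x)$ a nonzero multiple of a linear isometry; let $J(\Phi)(x)=\det\Phi'(x)$.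 Let $\zeta\in\mathcal S^D$. Then for every $k_\zeta|_O$-integrable function $f$ on $O$ (with values in $\mathbb R$, $\mathbb C$ or any real Banach space), the function $x\mapsto\big(\sqrt[n]{|J(\Phi)(x)|}\big)^{D} f(\Phi(x))$ is $k_\zeta|_{O'}$-integrable and $$\int_O f(y)\,k_\zeta(dy)=\int_{O'} f(\Phi(x))\Big(\sqrt[n]{|J(\Phi)(x)|}\Big)^{D}\,k_\zeta(dx).$$ -/

import Mathlib

open MeasureTheory Filter Topology Set
open scoped ENNReal NNReal

noncomputable section

namespace GenHausdorff

section Comparison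

variable {I : Type*}

/-- For `[0, ∞]`-valued functions `f`, `g` with filters `F`, `G` on the same set, the comparison
constant of `(f, F)` and `(g, G)`: the infimum over `U ∈ G` of the constants `r` such that `f ≤ r g`
on `U` if `F` is contained in `G` (as families of sets, which is `G ≤ F` in the order on filters),
and `∞` otherwise. -/
def ell (f : I → ℝ≥0∞) (F : Filter I) (g : I → ℝ≥0∞) (G : Filter I) : ℝ≥0∞ :=
  open Classical in
  if G ≤ F then ⨅ U ∈ G, ⨅ (r : ℝ≥0) (_ : ∀ x ∈ U, f x ≤ r * g x), (r : ℝ≥0∞) else ∞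

/-- The relation "`ℓ ≤ 1` in both directions". -/
def AsympEq (f : I → ℝ≥0∞) (F : Filter I) (g : I → ℝ≥0∞) (G : Filter I) : Prop :=
  ell f F g G ≤ 1 ∧ ell g G f F ≤ 1

end Comparison

/-- A monotone gauge of scale dimension `D`: nondecreasing, positive on `(0, ∞]`, and
`ς (lam * r) / ς r → lam ^ D` as `r → 0`, `r > 0`, for every `lam > 0`. -/
structure IsScaleGauge (D : ℝ) (ς : ℝ≥0∞ → ℝ≥0∞) : Prop where
  mono : Monotone ς
  pos : ∀ r, 0 < r → 0 < ς r
  tendsto : ∀ lam : ℝ≥0, 0 < lam →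
    Tendsto (fun r : ℝ≥0∞ => ς (lam * r) / ς r) (𝓝[>] 0) (𝓝 ((lam : ℝ≥0∞) ^ D))

/-- The class `𝒮^D`: functions on `[0, ∞]`, carrying the filter of neighbourhoods of `0`, that are
asymptotically equal to a monotone gauge of scale dimension `D`. -/
def scaleClass (D : ℝ) : Set (ℝ≥0∞ → ℝ≥0∞) :=
  {η | ∃ ς, IsScaleGauge D ς ∧ AsympEq η (𝓝 0) ς (𝓝 0)}

section Caratheodory

variable {X : Type*}

/-- The outer measure `A ↦ inf ∑ ζ S`, the infimum over the countable (possibly finite or empty)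
covers of `A` by members of `U`. -/
def coverOuter (ζ : Set X → ℝ≥0∞) (U : Set (Set X)) : OuterMeasure X where
  measureOf A := ⨅ (C : Set (Set X)) (_ : C.Countable) (_ : C ⊆ U) (_ : A ⊆ ⋃₀ C), ∑' S : C, ζ S
  empty := by
    refine le_antisymm ?_ bot_le
    refine (iInf_le_of_le ∅ <| iInf_le_of_le countable_empty <|
      iInf_le_of_le (empty_subset _) <| iInf_le_of_le (empty_subset _) ?_)
    simp
  mono := by
    intro A B hAB
    refine le_iInf fun C => le_iInf fun hc => le_iInf fun hU => le_iInf fun hB => ?_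
    exact iInf_le_of_le C <| iInf_le_of_le hc <| iInf_le_of_le hU <|
      iInf_le_of_le (hAB.trans hB) le_rfl
  iUnion_nat := by
    intro s _
    refine ENNReal.le_of_forall_pos_le_add fun ε hε hfin => ?_
    obtain ⟨ε', hε', hsum⟩ :=
      ENNReal.exists_pos_sum_of_countable (ENNReal.coe_pos.2 hε).ne' ℕ
    have hlt : ∀ i, ∃ C : Set (Set X), C.Countable ∧ C ⊆ U ∧ s i ⊆ ⋃₀ C ∧
        ∑' S : C, ζ S ≤ (⨅ (C : Set (Set X)) (_ : C.Countable) (_ : C ⊆ U) (_ : s i ⊆ ⋃₀ C),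
          ∑' S : C, ζ S) + ε' i := by
      intro i
      have hne := ENNReal.ne_top_of_tsum_ne_top hfin.ne i
      have := ENNReal.lt_add_right hne (ENNReal.coe_pos.2 (hε' i)).ne'
      simp only [iInf_lt_iff] at this
      obtain ⟨C, hc, hU, hs, h⟩ := this
      exact ⟨C, hc, hU, hs, h.le⟩
    choose C hc hU hs hC using hlt
    refine iInf_le_of_le (⋃ i, C i) <| iInf_le_of_le (countable_iUnion hc) <|
      iInf_le_of_le (iUnion_subset hU) <| iInf_le_of_le ?_ ?_
    · refine iUnion_subset fun i => (hs i).trans ?_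
      exact sUnion_subset_sUnion (subset_iUnion C i)
    · calc ∑' S : ↥(⋃ i, C i), ζ S ≤ ∑' i, ∑' S : C i, ζ S := ENNReal.tsum_iUnion_le_tsum ζ C
        _ ≤ ∑' i, (_ + (ε' i : ℝ≥0∞)) := ENNReal.tsum_le_tsum hC
        _ = _ := ENNReal.tsum_add
        _ ≤ _ := by gcongr

/-- The Carathéodory construction for a set function `ζ` and a filter `F` on the subsets of `X`. -/
def caratheodory (ζ : Set X → ℝ≥0∞) (F : Filter (Set X)) : OuterMeasure X :=
  ⨆ U ∈ F, coverOuter ζ U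

theorem caratheodory_apply (ζ : Set X → ℝ≥0∞) (F : Filter (Set X)) (A : Set X) :
    caratheodory ζ F A = ⨆ U ∈ F, ⨅ (C : Set (Set X)) (_ : C.Countable) (_ : C ⊆ U)
      (_ : A ⊆ ⋃₀ C), ∑' S : C, ζ S := by
  simp only [caratheodory, OuterMeasure.iSup_apply]
  rfl

end Caratheodory

section Metric

variable {X : Type*} [EMetricSpace X]

variable (X) in
/-- The filter on subsets of `X` generated by the families `{S | diam S ≤ ε}`, `ε > 0`, i.e. the
preimage of the neighbourhood filter of `0` under the diameter. -/
def smallSets : Filter (Set X) := comap Metric.ediam (𝓝 0)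

/-- The outer measure `k_ζ` on a metric space: the Carathéodory construction applied to
`S ↦ ζ (diam S)` and the filter of small sets. -/
def outer (ζ : ℝ≥0∞ → ℝ≥0∞) : OuterMeasure X :=
  caratheodory (fun S => ζ (Metric.ediam S)) (smallSets X)

theorem outer_eq_mkMetric (ζ : ℝ≥0∞ → ℝ≥0∞) :
    (outer ζ : OuterMeasure X) = OuterMeasure.mkMetric ζ := by
  have key : ∀ U ∈ smallSets X, ∃ r > 0, {S : Set X | Metric.ediam S ≤ r} ⊆ U := by
    intro U hU
    obtain ⟨V, hV, hVU⟩ := hU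
    obtain ⟨r, hr, hrV⟩ := (ENNReal.nhds_zero_basis_Iic).mem_iff.1 hV
    exact ⟨r, hr, fun S hS => hVU (hrV hS)⟩
  refine le_antisymm ?_ ?_
  · refine iSup₂_le fun U hU => ?_
    obtain ⟨r, hr, hrU⟩ := key U hU
    refine le_trans ?_ (le_iSup₂ (f := fun r (_ : r > 0) =>
      OuterMeasure.mkMetric'.pre (fun S : Set X => ζ (Metric.ediam S)) r) r hr)
    rw [OuterMeasure.mkMetric'.le_pre]
    intro S hS
    refine iInf_le_of_le {S} <| iInf_le_of_le (countable_singleton S) <|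
      iInf_le_of_le (singleton_subset_iff.2 (hrU hS)) <| iInf_le_of_le (by simp) ?_
    simp
  · refine iSup₂_le fun r hr => ?_
    have hmem : {S : Set X | Metric.ediam S ≤ r} ∈ smallSets X :=
      ⟨Iic r, Iic_mem_nhds hr, fun S hS => hS⟩
    refine le_trans ?_ (le_iSup₂ (f := fun U (_ : U ∈ smallSets X) =>
      coverOuter (fun S : Set X => ζ (Metric.ediam S)) U) _ hmem)
    intro A
    refine le_iInf fun C => le_iInf fun hc => le_iInf fun hU => le_iInf fun hA => ?_
    refine (measure_mono hA).trans ?_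
    rw [sUnion_eq_biUnion]
    refine (measure_biUnion_le _ hc _).trans ?_
    exact ENNReal.tsum_le_tsum fun S => OuterMeasure.mkMetric'.pre_le (hU S.2)

theorem le_caratheodory_outer [MeasurableSpace X] [BorelSpace X] (ζ : ℝ≥0∞ → ℝ≥0∞) :
    ‹MeasurableSpace X› ≤ (outer ζ : OuterMeasure X).caratheodory := by
  rw [outer_eq_mkMetric]
  exact (OuterMeasure.mkMetric'_isMetric _).le_caratheodory

/-- The outer measure `k_ζ` as a Borel measure. -/
def measure [MeasurableSpace X] [BorelSpace X] (ζ : ℝ≥0∞ → ℝ≥0∞) : Measure X :=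
  (outer ζ).toMeasure (le_caratheodory_outer ζ)

end Metric

/-- `Φ` is a conformal map from `O'` onto `O`: a bijection of `O'` onto `O` whose derivative exists
at each point of `O'` and is a nonzero multiple of a linear isometry. -/
structure IsConformalOnto {E : Type*} [NormedAddCommGroup E] [NormedSpace ℝ E]
    (Φ : E → E) (O' O : Set E) : Prop where
  bijOn : BijOn Φ O' O
  conformalAt : ∀ x ∈ O', ConformalAt Φ x

end GenHausdorff

end

noncomputable section

namespace GenHausdorff

/-! ### Regular variation of gauges near 0 -/

section Gauge

/-! A `b`-Lipschitz map multiplies diameters by at most `b`, so by regular variation of the gauge it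
multiplies the measure by at most `b ^ D` (`IsScaleGauge.measure_image_le`). Asymptotically equal
gauges give the same measure, so a monotone gauge suffices.

A conformal map has at each point a dilation factor `c = |det| ^ (1 / n)`. For `q > 1` the domain
splits into countably many Borel pieces on which the map distorts distances by factors in `[a, q *
a]`, with `c` also between `a` and `q * a`. On each piece the measure of the image and `∫ c ^ D`
agree up to `q ^ D`; summing and letting `q → 1` gives equality
(`IsScaleGauge.measure_image_eq_lintegral`). This needs neither σ-finiteness of the measure nor
continuity of the derivative. Hence the measure with density `c ^ D` is carried to the measure on
the image, and integrals follow. -/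

theorem eventually_le_mul_of_ell_le_one {f g : ℝ≥0∞ → ℝ≥0∞} {F G : Filter ℝ≥0∞}
    (h : ell f F g G ≤ 1) {q : ℝ≥0} (hq : 1 < q) : ∀ᶠ x in G, f x ≤ q * g x := by
  unfold ell at h
  split_ifs at h with hFG
  · have h' := h.trans_lt (ENNReal.coe_lt_coe.2 hq)
    simp only [iInf_lt_iff] at h'
    obtain ⟨U, hU, r, hr, hrq⟩ := h'
    filter_upwards [hU] with x hx
    exact (hr x hx).trans (by gcongr)
  · simp at h

/-- An inequality that holds up to every factor `q ^ D` with `q > 1` holds. -/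
theorem le_of_forall_one_lt_le_rpow_mul {D : ℝ} {x y : ℝ≥0∞}
    (h : ∀ q : ℝ≥0, 1 < q → x ≤ (q : ℝ≥0∞) ^ D * y) : x ≤ y := by
  have hlim : Tendsto (fun q : ℝ≥0 => (q : ℝ≥0∞) ^ D * y) (𝓝[>] 1) (𝓝 (1 * y)) := by
    refine ENNReal.Tendsto.mul_const ?_ (Or.inl one_ne_zero)
    have h1 : Tendsto (fun q : ℝ≥0 => (q : ℝ≥0∞) ^ D) (𝓝 1) (𝓝 (((1 : ℝ≥0) : ℝ≥0∞) ^ D)) :=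
      (ENNReal.continuous_rpow_const.tendsto _).comp
        (ENNReal.continuous_coe.tendsto 1)
    simpa using h1.mono_left nhdsWithin_le_nhds
  rw [one_mul] at hlim
  exact ge_of_tendsto hlim (eventually_nhdsWithin_of_forall fun q hq => h q hq)

theorem le_of_forall_one_lt_le_mul {x y : ℝ≥0∞}
    (h : ∀ q : ℝ≥0, 1 < q → x ≤ (q : ℝ≥0∞) * y) : x ≤ y :=
  le_of_forall_one_lt_le_rpow_mul (D := 1) fun q hq => by simpa using h q hq

variable {D : ℝ} {ς : ℝ≥0∞ → ℝ≥0∞}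

/-- In `ℝ≥0∞` one has `∞ / ∞ = 0`, whereas the quotient for `lam = 1` tends to 1. -/
theorem IsScaleGauge.eventually_ne_top (h : IsScaleGauge D ς) : ∀ᶠ r in 𝓝[>] 0, ς r ≠ ∞ := by
  have h1 := h.tendsto 1 one_pos
  have h2 : (0 : ℝ≥0∞) < ((1 : ℝ≥0) : ℝ≥0∞) ^ D := by simp
  filter_upwards [h1.eventually (lt_mem_nhds h2)] with r hr htop
  simp [htop] at hr

theorem IsScaleGauge.eventually_nhdsGT_le (h : IsScaleGauge D ς) {b : ℝ≥0} (hb : 0 < b)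
    {t : ℝ≥0∞} (ht : (b : ℝ≥0∞) ^ D < t) : ∀ᶠ r in 𝓝[>] 0, ς (b * r) ≤ t * ς r := by
  filter_upwards [(h.tendsto b hb).eventually (gt_mem_nhds ht), h.eventually_ne_top,
    self_mem_nhdsWithin] with r hr hfin h0
  exact (ENNReal.div_le_iff (h.pos r h0).ne' hfin).1 hr.le

/-- Halving a small argument shrinks `ς` by a factor `t < 1`; iterating bounds `ς 0` by `t ^ k * ς
r`, which tends to 0. -/
theorem IsScaleGauge.apply_zero (h : IsScaleGauge D ς) (hD : 0 < D) : ς 0 = 0 := by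
  have hlt : (((2 : ℝ≥0)⁻¹ : ℝ≥0) : ℝ≥0∞) ^ D < 1 := by
    apply ENNReal.rpow_lt_one _ hD
    rw [← ENNReal.coe_one, ENNReal.coe_lt_coe]
    exact inv_lt_one_of_one_lt₀ one_lt_two
  obtain ⟨t, ht, ht1⟩ := exists_between hlt
  have hev := (h.eventually_nhdsGT_le (b := 2⁻¹) (by positivity) ht).and h.eventually_ne_top
  obtain ⟨R, hR, hsub⟩ := (mem_nhdsGT_iff_exists_Ioo_subset' zero_lt_one).1 hev
  have key : ∀ k : ℕ, ∀ r ∈ Ioo 0 R, ς 0 ≤ t ^ k * ς r := by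
    intro k
    induction k with
    | zero => intro r _; simpa using h.mono zero_le
    | succ k ih =>
      intro r hr
      have hr' : (((2 : ℝ≥0)⁻¹ : ℝ≥0) : ℝ≥0∞) * r ∈ Ioo 0 R := by
        refine ⟨ENNReal.mul_pos (by simp) hr.1.ne', lt_of_le_of_lt ?_ hr.2⟩
        refine mul_le_of_le_one_left' ?_
        rw [← ENNReal.coe_one, ENNReal.coe_le_coe]
        exact (inv_lt_one_of_one_lt₀ one_lt_two).le
      calc ς 0 ≤ t ^ k * ς (((2 : ℝ≥0)⁻¹ : ℝ≥0) * r) := ih _ hr'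
        _ ≤ t ^ k * (t * ς r) := by gcongr; exact (hsub hr).1
        _ = t ^ (k + 1) * ς r := by ring
  obtain ⟨r, hr⟩ := exists_between (show (0 : ℝ≥0∞) < R from hR)
  have hlim : Tendsto (fun k : ℕ => t ^ k * ς r) atTop (𝓝 (0 * ς r)) :=
    ENNReal.Tendsto.mul_const (ENNReal.tendsto_pow_atTop_nhds_zero_of_lt_one ht1)
      (Or.inr (hsub hr).2)
  rw [zero_mul] at hlim
  exact le_antisymm (ge_of_tendsto' hlim fun k => key k r hr) zero_le

theorem IsScaleGauge.eventually_le (h : IsScaleGauge D ς) (hD : 0 ≤ D) {b : ℝ≥0} (hb : 0 < b)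
    {q : ℝ≥0} (hq : 1 < q) :
    ∀ᶠ r in 𝓝 0, ς (b * r) ≤ (q * (b : ℝ≥0∞) ^ D) * ς r := by
  have hbD : (b : ℝ≥0∞) ^ D < q * (b : ℝ≥0∞) ^ D := by
    have h0 : (b : ℝ≥0∞) ^ D ≠ 0 := by simp [hb.ne']
    have h1 : (b : ℝ≥0∞) ^ D ≠ ∞ := by simp [hD]
    calc (b : ℝ≥0∞) ^ D = 1 * (b : ℝ≥0∞) ^ D := (one_mul _).symm
      _ < q * (b : ℝ≥0∞) ^ D := ENNReal.mul_lt_mul_left h0 h1 (by exact_mod_cast hq)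
  have hGT := eventually_nhdsWithin_iff.1 (h.eventually_nhdsGT_le hb hbD)
  filter_upwards [hGT] with r hr
  rcases eq_or_ne r 0 with rfl | hr0
  · rw [mul_zero]
    -- For `D = 0` the value `ς 0` may be positive (counting measure), but the factor is then `q ≥
    -- 1`.
    rcases hD.eq_or_lt with rfl | hD'
    · rw [ENNReal.rpow_zero, mul_one]
      exact le_mul_of_one_le_left' (by exact_mod_cast hq.le)
    · simp [h.apply_zero hD']
  · exact hr (pos_iff_ne_zero.2 hr0)

end Gauge

/-! ### Lipschitz maps and the measures -/

section Metric

variable {X Y : Type*} [EMetricSpace X] [MeasurableSpace X] [BorelSpace X]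
  [EMetricSpace Y] [MeasurableSpace Y] [BorelSpace Y]

theorem measure_eq_mkMetric (ζ : ℝ≥0∞ → ℝ≥0∞) :
    (measure ζ : Measure X) = Measure.mkMetric ζ := by
  unfold measure Measure.mkMetric
  congr 1
  exact outer_eq_mkMetric ζ

theorem mkMetric_le_of_ell_le_one {ζ ς : ℝ≥0∞ → ℝ≥0∞} (h : ell ζ (𝓝 0) ς (𝓝 0) ≤ 1) :
    (Measure.mkMetric ζ : Measure X) ≤ Measure.mkMetric ς := by
  refine Measure.le_iff'.2 fun s => le_of_forall_one_lt_le_mul fun q hq => ?_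
  exact Measure.mkMetric_mono_smul (c := q) ENNReal.coe_ne_top
    (by exact_mod_cast (zero_lt_one.trans hq).ne')
    ((eventually_le_mul_of_ell_le_one h hq).filter_mono nhdsWithin_le_nhds) s

theorem AsympEq.measure_eq {ζ ς : ℝ≥0∞ → ℝ≥0∞} (h : AsympEq ζ (𝓝 0) ς (𝓝 0)) :
    (measure ζ : Measure X) = measure ς := by
  rw [measure_eq_mkMetric, measure_eq_mkMetric]
  exact le_antisymm (mkMetric_le_of_ell_le_one h.1) (mkMetric_le_of_ell_le_one h.2)

theorem mkMetric_image_le {m : ℝ≥0∞ → ℝ≥0∞} (hm : Monotone m) {b : ℝ≥0} {f : X → Y} {s : Set X}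
    (hf : LipschitzOnWith b f s) :
    Measure.mkMetric m (f '' s) ≤ Measure.mkMetric (fun r => m (b * r)) s := by
  simp only [Measure.mkMetric_apply]
  refine iSup_le fun R => iSup_le fun hR => ?_
  have hlim : Tendsto (fun d : ℝ≥0∞ => (b : ℝ≥0∞) * d) (𝓝 0) (𝓝 0) := by
    simpa using ENNReal.Tendsto.const_mul (tendsto_id (α := ℝ≥0∞) (x := 𝓝 0))
      (Or.inr (ENNReal.coe_ne_top (r := b)))
  rcases ENNReal.nhds_zero_basis_Iic.eventually_iff.1 (hlim.eventually (gt_mem_nhds hR)) with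
    ⟨δ, δ0, H⟩
  have hdiam : ∀ t : Set X, Metric.ediam (f '' (t ∩ s)) ≤ b * Metric.ediam t := fun t =>
    (by simpa using (hf.mono inter_subset_right).holderOnWith.ediam_image_le :
      Metric.ediam (f '' (t ∩ s)) ≤ b * Metric.ediam (t ∩ s)).trans
      (by gcongr; exact inter_subset_left)
  refine le_iSup₂_of_le δ δ0 <| iInf₂_mono' fun t hst ↦
    ⟨fun n => f '' (t n ∩ s), ?_, iInf_mono' fun htδ ↦
      ⟨fun n => (hdiam (t n)).trans (H (htδ n)).le, ?_⟩⟩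
  · grw [← image_iUnion, ← iUnion_inter, ← hst, inter_self]
  · refine ENNReal.tsum_le_tsum fun n => ?_
    simp only [iSup_le_iff, image_nonempty]
    intro hft
    simp only [Nonempty.mono ((t n).inter_subset_left) hft, ciSup_pos]
    exact hm (hdiam (t n))

/-- A `b`-Lipschitz map enlarges the generalized Hausdorff measure of a gauge of scale dimension
`D` at most by the factor `b ^ D`. -/
theorem IsScaleGauge.measure_image_le {D : ℝ} {ς : ℝ≥0∞ → ℝ≥0∞} (h : IsScaleGauge D ς)
    (hD : 0 ≤ D) {b : ℝ≥0} (hb : 0 < b) {f : X → Y} {s : Set X} (hf : LipschitzOnWith b f s) :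
    measure ς (f '' s) ≤ (b : ℝ≥0∞) ^ D * measure ς s := by
  rw [measure_eq_mkMetric, measure_eq_mkMetric]
  refine le_of_forall_one_lt_le_mul fun q hq => ?_
  refine (mkMetric_image_le h.mono hf).trans ?_
  rw [← mul_assoc]
  refine Measure.mkMetric_mono_smul (c := q * (b : ℝ≥0∞) ^ D) ?_ ?_
    ((h.eventually_le hD hb hq).filter_mono nhdsWithin_le_nhds) s
  · exact ENNReal.mul_ne_top ENNReal.coe_ne_top (by simp [hD])
  · simp [hb.ne', (zero_lt_one.trans hq).ne']

end Metric

/-- `c x` is the metric dilation factor of `Φ` at each point `x` of `s`. -/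
def HasDilationOn {X Y : Type*} [MetricSpace X] [MetricSpace Y] (Φ : X → Y) (c : X → ℝ≥0)
    (s : Set X) : Prop :=
  ∀ x ∈ s, ∀ a b : ℝ≥0, a < c x → c x < b →
    ∀ᶠ y in 𝓝 x, a * nndist x y ≤ nndist (Φ x) (Φ y) ∧ nndist (Φ x) (Φ y) ≤ b * nndist x y

/-! ### Decomposition into near-similarities -/

section Cover

variable {X Y : Type*} [MetricSpace X] [MeasurableSpace X] [BorelSpace X]
  [MetricSpace Y] {Φ : X → Y} {c : X → ℝ≥0} {s : Set X}

/-- By continuity the set is relatively closed in `s`: for fixed `y` it is the union of the closed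
conditions `r ≤ dist x y` and the two inequalities. -/
theorem measurableSet_local_dilation (hs : MeasurableSet s) (hΦ : ContinuousOn Φ s)
    (a b : ℝ≥0) (r : ℝ) :
    MeasurableSet {x ∈ s | ∀ y ∈ s, dist x y < r →
      a * nndist x y ≤ nndist (Φ x) (Φ y) ∧ nndist (Φ x) (Φ y) ≤ b * nndist x y} := by
  have hc : Continuous fun x : s => Φ x := continuousOn_iff_continuous_domRestrict.1 hΦ
  have hcl : IsClosed {x : s | ∀ y : s, dist (x : X) y < r →
      a * nndist (x : X) y ≤ nndist (Φ x) (Φ y) ∧ nndist (Φ x) (Φ y) ≤ b * nndist (x : X) y} := by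
    simp only [ofPred_forall, imp_iff_not_or, not_lt]
    refine isClosed_iInter fun y => ?_
    have hd : Continuous fun x : s => nndist (x : X) (y : X) :=
      continuous_subtype_val.nndist continuous_const
    have hlow : IsClosed {x : s | a * nndist (x : X) y ≤ nndist (Φ x) (Φ y)} :=
      isClosed_le (continuous_const.mul hd) (hc.nndist continuous_const)
    have hup : IsClosed {x : s | nndist (Φ x) (Φ y) ≤ b * nndist (x : X) y} :=
      isClosed_le (hc.nndist continuous_const) (continuous_const.mul hd)
    exact (isClosed_le continuous_const (continuous_subtype_val.dist continuous_const)).union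
      (hlow.inter hup)
  convert! hs.subtype_image hcl.measurableSet using 1
  ext x
  simp [and_comm]

/-- A set on which `Φ` has a measurable positive dilation factor is covered by countably many
measurable pieces, on each of which `Φ` is a similarity up to a factor `q`. -/
theorem HasDilationOn.exists_cover [SecondCountableTopology X] (h : HasDilationOn Φ c s) (hs : MeasurableSet s)
    (hΦ : ContinuousOn Φ s) (hc : Measurable c) (hpos : ∀ x ∈ s, 0 < c x) {q : ℝ≥0} (hq : 1 < q) :
    ∃ P : ℕ → Set X, (∀ i, MeasurableSet (P i)) ∧ s ⊆ ⋃ i, P i ∧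
      ∀ i, ∃ a : ℝ≥0, 0 < a ∧ ∀ x ∈ P i, a < c x ∧ c x < q * a ∧ ∀ y ∈ P i,
        a * nndist x y ≤ nndist (Φ x) (Φ y) ∧ nndist (Φ x) (Φ y) ≤ q * a * nndist x y := by
  rcases s.eq_empty_or_nonempty with rfl | ⟨x₀, hx₀⟩
  · exact ⟨fun _ => ∅, by simp, by simp, fun _ => ⟨1, by simp⟩⟩
  have : Nonempty X := ⟨x₀⟩
  let A := {a : ℚ // 0 < a}
  have : Nonempty A := ⟨⟨1, one_pos⟩⟩
  let val : A → ℝ≥0 := fun a => Real.toNNReal (a : ℚ)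
  let rad : ℕ → ℝ := fun j => 1 / ((j : ℝ) + 1)
  -- Balls of half the radius keep any two points of a piece within the radius where the distance
  -- bounds hold.
  let Q : ℕ × ℕ × A → Set X := fun i =>
    ({x ∈ s | ∀ y ∈ s, dist x y < rad i.1 → val i.2.2 * nndist x y ≤ nndist (Φ x) (Φ y) ∧
        nndist (Φ x) (Φ y) ≤ q * val i.2.2 * nndist x y} ∩
      c ⁻¹' Ioo (val i.2.2) (q * val i.2.2)) ∩
      Metric.ball (TopologicalSpace.denseSeq X i.2.1) (rad i.1 / 2)
  obtain ⟨e, he⟩ := exists_surjective_nat (ℕ × ℕ × A)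
  refine ⟨fun i => Q (e i), fun i => ?_, fun x hx => ?_, fun i => ?_⟩
  · exact ((measurableSet_local_dilation hs hΦ _ _ _).inter (hc measurableSet_Ioo)).inter
      measurableSet_ball
  · have hcx := hpos x hx
    have hlt : c x / q < c x := div_lt_self hcx hq
    -- A rational in `(c x / q, c x)` gives `a < c x < q * a`.
    obtain ⟨p, -, ha, hac⟩ := (NNReal.lt_iff_exists_rat_btwn _ _).1 hlt
    set a : ℝ≥0 := Real.toNNReal p
    have hq0 : 0 < q := zero_lt_one.trans hq
    have ha0 : (0 : ℝ≥0) < a := (div_pos hcx hq0).trans ha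
    have hqa : c x < q * a := by
      rw [div_lt_iff₀ hq0] at ha
      rwa [mul_comm]
    obtain ⟨ε, hε, hball⟩ := Metric.eventually_nhds_iff.1 (h x hx a (q * a) hac hqa)
    obtain ⟨j, hj⟩ := exists_nat_one_div_lt hε
    obtain ⟨d, hd⟩ := (TopologicalSpace.denseRange_denseSeq X).exists_dist_lt x
      (show 0 < rad j / 2 by positivity)
    obtain ⟨i, hi⟩ := he (j, d, ⟨p, by simpa [a] using ha0⟩)
    refine mem_iUnion.2 ⟨i, ?_⟩
    rw [hi]
    refine ⟨⟨⟨hx, fun y _ hy => hball ?_⟩, hac, hqa⟩, hd⟩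
    rw [dist_comm]
    exact hy.trans hj
  · refine ⟨val (e i).2.2, by simpa [val] using (e i).2.2.2, fun x hx => ⟨hx.1.2.1, hx.1.2.2,
      fun y hy => hx.1.1.2 y hy.1.1.1 ?_⟩⟩
    have h1 := Metric.mem_ball.1 hx.2
    have h2 := Metric.mem_ball.1 hy.2
    calc dist x y ≤ _ := dist_triangle_right x y _
      _ < _ := add_lt_add h1 h2
      _ = _ := add_halves _

end Cover

/-! ### Measures of images -/

section Transform

variable {X Y : Type*} [MetricSpace X] [MeasurableSpace X] [BorelSpace X]
  [MetricSpace Y] [MeasurableSpace Y] [BorelSpace Y] {Φ : X → Y} {c : X → ℝ≥0} {s : Set X}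
  {D : ℝ} {ς : ℝ≥0∞ → ℝ≥0∞}

/-- The inverse on the image is `a⁻¹`-Lipschitz, so the Lipschitz bound applies to it. -/
theorem IsScaleGauge.measure_le_of_expanding (h : IsScaleGauge D ς) (hD : 0 ≤ D) {a : ℝ≥0}
    (ha : 0 < a) (hexp : ∀ x ∈ s, ∀ y ∈ s, a * nndist x y ≤ nndist (Φ x) (Φ y)) :
    (a : ℝ≥0∞) ^ D * measure ς s ≤ measure ς (Φ '' s) := by
  rcases s.eq_empty_or_nonempty with rfl | ⟨x₀, hx₀⟩
  · simp
  have : Nonempty X := ⟨x₀⟩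
  have hinj : InjOn Φ s := fun x hx y hy hxy => by
    have h1 := hexp x hx y hy
    rw [hxy, nndist_self, nonpos_iff_eq_zero, mul_eq_zero] at h1
    exact nndist_eq_zero.1 (h1.resolve_left ha.ne')
  have hinv : LeftInvOn (Function.invFunOn Φ s) Φ s := hinj.leftInvOn_invFunOn
  have hlip : LipschitzOnWith a⁻¹ (Function.invFunOn Φ s) (Φ '' s) := by
    refine LipschitzOnWith.of_dist_le_mul ?_
    rintro _ ⟨x, hx, rfl⟩ _ ⟨y, hy, rfl⟩
    rw [hinv hx, hinv hy, ← coe_nndist, ← coe_nndist, ← NNReal.coe_mul, NNReal.coe_le_coe,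
      ← div_eq_inv_mul, le_div_iff₀ ha, mul_comm]
    exact hexp x hx y hy
  have hle := h.measure_image_le hD (inv_pos.2 ha) hlip
  rw [hinv.image_image, ENNReal.coe_inv ha.ne', ENNReal.inv_rpow] at hle
  rw [mul_comm, ← ENNReal.le_div_iff_mul_le, div_eq_mul_inv, mul_comm]
  · exact hle
  · left; simp [ha.ne']
  · left; simp [hD]

/-- The transformation rule for the measures of images under an injective continuous map with a
measurable positive dilation factor. -/
theorem IsScaleGauge.measure_image_eq_lintegral [PolishSpace X] (h : IsScaleGauge D ς)
    (hD : 0 ≤ D) (hdil : HasDilationOn Φ c s) (hs : MeasurableSet s) (hΦ : ContinuousOn Φ s)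
    (hinj : InjOn Φ s) (hc : Measurable c) (hpos : ∀ x ∈ s, 0 < c x)
    {B : Set X} (hB : MeasurableSet B) (hBs : B ⊆ s) :
    measure ς (Φ '' B) = ∫⁻ x in B, (c x : ℝ≥0∞) ^ D ∂(measure ς) := by
  have key : ∀ q : ℝ≥0, 1 < q →
      measure ς (Φ '' B) ≤ (q : ℝ≥0∞) ^ D * ∫⁻ x in B, (c x : ℝ≥0∞) ^ D ∂(measure ς) ∧
      ∫⁻ x in B, (c x : ℝ≥0∞) ^ D ∂(measure ς) ≤ (q : ℝ≥0∞) ^ D * measure ς (Φ '' B) := by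
    intro q hq
    obtain ⟨P, hPm, hPc, hP⟩ := hdil.exists_cover hs hΦ hc hpos hq
    let T : ℕ → Set X := fun i => B ∩ disjointed P i
    have hTm : ∀ i, MeasurableSet (T i) := fun i => hB.inter (.disjointed hPm i)
    have hTd : Pairwise (Function.onFun Disjoint T) := fun i j hij =>
      (disjoint_disjointed P hij).mono inter_subset_right inter_subset_right
    have hTU : ⋃ i, T i = B := by
      rw [← inter_iUnion, iUnion_disjointed, inter_eq_left]
      exact hBs.trans hPc
    have hTs : ∀ i, T i ⊆ s := fun i => inter_subset_left.trans hBs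
    have himg : measure ς (Φ '' B) = ∑' i, measure ς (Φ '' T i) := by
      rw [← hTU, image_iUnion, measure_iUnion]
      · intro i j hij
        exact (hTd hij).image hinj (hTs i) (hTs j)
      -- Lusin–Souslin: injective continuous images of Borel sets in a Polish space are Borel.
      · exact fun i => (hTm i).image_of_continuousOn_injOn (hΦ.mono (hTs i)) (hinj.mono (hTs i))
    have hint : ∫⁻ x in B, (c x : ℝ≥0∞) ^ D ∂(measure ς) =
        ∑' i, ∫⁻ x in T i, (c x : ℝ≥0∞) ^ D ∂(measure ς) := by
      rw [← hTU, lintegral_iUnion hTm hTd]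
    -- Both quantities lie between `a ^ D` and `(q * a) ^ D` times the measure of `T i`.
    have hpiece : ∀ i,
        measure ς (Φ '' T i) ≤ (q : ℝ≥0∞) ^ D * ∫⁻ x in T i, (c x : ℝ≥0∞) ^ D ∂(measure ς) ∧
        ∫⁻ x in T i, (c x : ℝ≥0∞) ^ D ∂(measure ς) ≤ (q : ℝ≥0∞) ^ D * measure ς (Φ '' T i) := by
      intro i
      obtain ⟨a, ha, hai⟩ := hP i
      have hTP : T i ⊆ P i := inter_subset_right.trans (disjointed_subset P i)
      have hup : measure ς (Φ '' T i) ≤ ((q * a : ℝ≥0) : ℝ≥0∞) ^ D * measure ς (T i) := by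
        refine h.measure_image_le hD (mul_pos (zero_lt_one.trans hq) ha)
          (LipschitzOnWith.of_dist_le_mul fun x hx y hy => ?_)
        exact_mod_cast ((hai x (hTP hx)).2.2 y (hTP hy)).2
      have hlow : (a : ℝ≥0∞) ^ D * measure ς (T i) ≤ measure ς (Φ '' T i) :=
        h.measure_le_of_expanding hD ha fun x hx y hy => ((hai x (hTP hx)).2.2 y (hTP hy)).1
      have hintlow : (a : ℝ≥0∞) ^ D * measure ς (T i) ≤
          ∫⁻ x in T i, (c x : ℝ≥0∞) ^ D ∂(measure ς) := by
        rw [← setLIntegral_const]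
        refine setLIntegral_mono' (hTm i) fun x hx => ?_
        gcongr
        exact (hai x (hTP hx)).1.le
      have hintup : ∫⁻ x in T i, (c x : ℝ≥0∞) ^ D ∂(measure ς) ≤
          ((q * a : ℝ≥0) : ℝ≥0∞) ^ D * measure ς (T i) := by
        rw [← setLIntegral_const]
        refine setLIntegral_mono' (hTm i) fun x hx => ?_
        gcongr
        exact (hai x (hTP hx)).2.1.le
      rw [ENNReal.coe_mul, ENNReal.mul_rpow_of_nonneg _ _ hD, mul_assoc] at hup hintup
      exact ⟨hup.trans (by gcongr), hintup.trans (by gcongr)⟩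
    rw [himg, hint, ← ENNReal.tsum_mul_left, ← ENNReal.tsum_mul_left]
    exact ⟨ENNReal.tsum_le_tsum fun i => (hpiece i).1, ENNReal.tsum_le_tsum fun i => (hpiece i).2⟩
  exact le_antisymm (le_of_forall_one_lt_le_rpow_mul fun q hq => (key q hq).1)
    (le_of_forall_one_lt_le_rpow_mul fun q hq => (key q hq).2)

end Transform

/-! ### Change of variables for integrals -/

section Integral

variable {X Y : Type*} [MetricSpace X] [MeasurableSpace X] [BorelSpace X] [PolishSpace X]
  [MetricSpace Y] [MeasurableSpace Y] [BorelSpace Y] {Φ : X → Y} {c : X → ℝ≥0} {s : Set X}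
  {D : ℝ} {ς : ℝ≥0∞ → ℝ≥0∞}

/-- Passing to the subtype `s` makes `Φ` a measurable map, since nothing is known of it off `s`. -/
theorem IsScaleGauge.map_withDensity_dilation (h : IsScaleGauge D ς)
    (hD : 0 ≤ D) (hdil : HasDilationOn Φ c s) (hs : MeasurableSet s) (hΦ : ContinuousOn Φ s)
    (hinj : InjOn Φ s) (hc : Measurable c) (hpos : ∀ x ∈ s, 0 < c x) :
    Measure.map (s.domRestrict Φ)
      (Measure.comap (↑) ((measure ς).withDensity fun x => ((c x ^ D : ℝ≥0) : ℝ≥0∞))) =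
      (measure ς).restrict (Φ '' s) := by
  have hmeas : Measurable (s.domRestrict Φ) :=
    (continuousOn_iff_continuous_domRestrict.1 hΦ).measurable
  ext B hB
  have himg : MeasurableSet ((↑) '' (s.domRestrict Φ ⁻¹' B) : Set X) :=
    hs.subtype_image (hmeas hB)
  have hsub : ((↑) '' (s.domRestrict Φ ⁻¹' B) : Set X) ⊆ s := by
    rintro _ ⟨x, _, rfl⟩
    exact x.2
  rw [Measure.map_apply hmeas hB, (MeasurableEmbedding.subtype_coe hs).comap_apply,
    withDensity_apply _ himg, Measure.restrict_apply hB]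
  simp only [ENNReal.coe_rpow_of_nonneg _ hD]
  rw [← h.measure_image_eq_lintegral hD hdil hs hΦ hinj hc hpos himg hsub]
  congr 1
  ext y
  simp only [mem_image, mem_inter_iff, mem_preimage, domRestrict_apply]
  constructor
  · rintro ⟨_, ⟨x, hx, rfl⟩, rfl⟩
    exact ⟨hx, x, x.2, rfl⟩
  · rintro ⟨hy, x, hx, rfl⟩
    exact ⟨x, ⟨⟨x, hx⟩, hy, rfl⟩, rfl⟩

variable {F : Type*} [NormedAddCommGroup F] [NormedSpace ℝ F]

theorem IsScaleGauge.integrableOn_image_iff [SecondCountableTopology Y] (h : IsScaleGauge D ς)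
    (hD : 0 ≤ D) (hdil : HasDilationOn Φ c s) (hs : MeasurableSet s) (hΦ : ContinuousOn Φ s)
    (hinj : InjOn Φ s) (hc : Measurable c) (hpos : ∀ x ∈ s, 0 < c x) (f : Y → F) :
    IntegrableOn f (Φ '' s) (measure ς) ↔
      IntegrableOn (fun x => ((c x : ℝ) ^ D) • f (Φ x)) s (measure ς) := by
  rw [IntegrableOn, ← h.map_withDensity_dilation hD hdil hs hΦ hinj hc hpos,
    (hΦ.measurableEmbedding hs hinj).integrable_map_iff]
  simp only [Set.domRestrict_eq, ← Function.comp_assoc]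
  rw [← (MeasurableEmbedding.subtype_coe hs).integrable_map_iff, map_comap_subtype_coe hs,
    restrict_withDensity hs,
    integrable_withDensity_iff_integrable_coe_smul₀ (hc.pow_const D).aemeasurable]
  simp_rw [IntegrableOn, NNReal.coe_rpow, Function.comp_apply]

theorem IsScaleGauge.integral_image_eq [SecondCountableTopology Y] (h : IsScaleGauge D ς)
    (hD : 0 ≤ D) (hdil : HasDilationOn Φ c s) (hs : MeasurableSet s) (hΦ : ContinuousOn Φ s)
    (hinj : InjOn Φ s) (hc : Measurable c) (hpos : ∀ x ∈ s, 0 < c x) (f : Y → F) :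
    ∫ y in Φ '' s, f y ∂(measure ς) =
      ∫ x in s, ((c x : ℝ) ^ D) • f (Φ x) ∂(measure ς) := by
  rw [← h.map_withDensity_dilation hD hdil hs hΦ hinj hc hpos,
    (hΦ.measurableEmbedding hs hinj).integral_map]
  simp only [Set.domRestrict_apply, ← Function.comp_apply (f := f)]
  rw [← (MeasurableEmbedding.subtype_coe hs).integral_map (g := fun x : X => (f ∘ Φ) x),
    map_comap_subtype_coe hs,
    setIntegral_withDensity_eq_setIntegral_smul₀ (hc.pow_const D).aemeasurable _ hs]
  simp only [NNReal.smul_def, NNReal.coe_rpow]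

end Integral

/-! ### Conformal maps have a dilation factor -/

section Conformal

variable {E : Type*} [NormedAddCommGroup E] [InnerProductSpace ℝ E]

/-- The ratio of a conformal linear endomorphism is the `dim E`-th root of `|det|`. -/
theorem norm_apply_of_isConformalMap [FiniteDimensional ℝ E] {L : E →L[ℝ] E} (hL : IsConformalMap L)
    (hE : 0 < Module.finrank ℝ E) :
    0 < |L.det| ^ (1 / (Module.finrank ℝ E : ℝ)) ∧
      ∀ v, ‖L v‖ = |L.det| ^ (1 / (Module.finrank ℝ E : ℝ)) * ‖v‖ := by
  obtain ⟨k, hk, li, rfl⟩ := hL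
  have hli : |LinearMap.det li.toLinearMap| = 1 := by
    rw [← LinearMap.normDet_eq_abs_det, li.normDet_eq_one]
  have hdet : |(k • li.toContinuousLinearMap).det| = |k| ^ Module.finrank ℝ E := by
    have : (k • li.toContinuousLinearMap).det = LinearMap.det (k • li.toLinearMap) := rfl
    rw [this, LinearMap.det_smul, abs_mul, hli, abs_pow, mul_one]
  rw [hdet, one_div, Real.pow_rpow_inv_natCast (abs_nonneg k) hE.ne']
  exact ⟨abs_pos.2 hk, fun v => by simp [norm_smul]⟩

theorem hasDilationOn_of_hasFDerivAt {Φ : E → E} {s : Set E} {c : E → ℝ≥0}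
    (hc : ∀ x ∈ s, ∃ L : E →L[ℝ] E, HasFDerivAt Φ L x ∧ ∀ v, ‖L v‖ = c x * ‖v‖) :
    HasDilationOn Φ c s := by
  intro x hx a b hac hcb
  obtain ⟨L, hL, hnorm⟩ := hc x hx
  have hlow : (0 : ℝ) < c x - a := sub_pos.2 (by exact_mod_cast hac)
  have hup : (0 : ℝ) < b - c x := sub_pos.2 (by exact_mod_cast hcb)
  -- The gaps `c x - a` and `b - c x` serve as the tolerances for the linearization error.
  filter_upwards [hL.isLittleO.def hlow, hL.isLittleO.def hup] with y h1 h2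
  have hv := hnorm (y - x)
  rw [← NNReal.coe_le_coe, ← NNReal.coe_le_coe]
  push_cast
  rw [dist_comm x y, dist_comm (Φ x), dist_eq_norm, dist_eq_norm]
  have t1 := norm_le_norm_add_norm_sub' (L (y - x)) (Φ y - Φ x)
  have t2 := norm_le_norm_add_norm_sub' (Φ y - Φ x) (L (y - x))
  rw [norm_sub_rev (L (y - x))] at t1
  constructor <;> nlinarith

end Conformal

end GenHausdorff

end

theorem proposition2 {n : ℕ} (hn : 0 < n) {D : ℝ} (hD : 0 ≤ D)
    {ζ : ℝ≥0∞ → ℝ≥0∞} (hζ : ζ ∈ GenHausdorff.scaleClass D)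
    {O' O : Set (EuclideanSpace ℝ (Fin n))} (hO' : IsOpen O') (hO : IsOpen O)
    {Φ : EuclideanSpace ℝ (Fin n) → EuclideanSpace ℝ (Fin n)}
    (hΦ : GenHausdorff.IsConformalOnto Φ O' O)
    {F : Type*} [NormedAddCommGroup F] [NormedSpace ℝ F] [CompleteSpace F]
    {f : EuclideanSpace ℝ (Fin n) → F}
    (hf : IntegrableOn f O (GenHausdorff.measure ζ)) :
    IntegrableOn (fun x => ((|(fderiv ℝ Φ x).det| ^ (1 / (n : ℝ))) ^ D) • f (Φ x)) O'
        (GenHausdorff.measure ζ) ∧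
      ∫ y in O, f y ∂(GenHausdorff.measure ζ) =
        ∫ x in O', ((|(fderiv ℝ Φ x).det| ^ (1 / (n : ℝ))) ^ D) • f (Φ x)
          ∂(GenHausdorff.measure ζ) := by
  obtain ⟨ς, hς, hζς⟩ := hζ
  rw [hζς.measure_eq] at hf ⊢
  let c : EuclideanSpace ℝ (Fin n) → ℝ≥0 :=
    fun x => ⟨|(fderiv ℝ Φ x).det| ^ (1 / (n : ℝ)), by positivity⟩
  -- `fderiv` is Borel for an arbitrary map, being 0 where the map is not differentiable.
  have hcm : Measurable c := by
    refine Measurable.subtype_mk ?_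
    exact (ContinuousLinearMap.continuous_det.measurable.comp
      (measurable_fderiv ℝ Φ)).abs.pow_const _
  have hder : ∀ x ∈ O', HasFDerivAt Φ (fderiv ℝ Φ x) x := fun x hx =>
    (hΦ.conformalAt x hx).differentiableAt.hasFDerivAt
  have hratio : ∀ x ∈ O', 0 < c x ∧ ∀ v, ‖fderiv ℝ Φ x v‖ = c x * ‖v‖ := fun x hx => by
    have h := GenHausdorff.norm_apply_of_isConformalMap
      (conformalAt_iff_isConformalMap_fderiv.1 (hΦ.conformalAt x hx)) (by simpa using hn)
    rw [finrank_euclideanSpace_fin] at h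
    exact h
  have hdil : GenHausdorff.HasDilationOn Φ c O' :=
    GenHausdorff.hasDilationOn_of_hasFDerivAt fun x hx => ⟨_, hder x hx, (hratio x hx).2⟩
  have hcont : ContinuousOn Φ O' := fun x hx => (hder x hx).continuousAt.continuousWithinAt
  have hpos : ∀ x ∈ O', 0 < c x := fun x hx => (hratio x hx).1
  rw [← hΦ.bijOn.image_eq] at hf ⊢
  exact ⟨(hς.integrableOn_image_iff hD hdil hO'.measurableSet hcont hΦ.bijOn.injOn hcm hpos f).1 hf,
    hς.integral_image_eq hD hdil hO'.measurableSet hcont hΦ.bijOn.injOn hcm hpos f⟩
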